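/- Let $n\ge 1$, and let $M$ and $K$ be nonsingular real $n\times n$ matrices that are totally positive (all their minors are nonnegative), with $K$ stochastic (nonnegative, with every row sum equal to $1$). Put $A:=MK$ and $C:=K^TM$. For a real matrix $B=(b_{ij})$ write $|B|:=(|b_{ij}|)$, and say that a nonnegative matrix $B$ dominates a matrix $D$ if $|d_{ij}|\le b_{ij}$ for all $i,j$. For a nonsingular matrix $B$ let $\kappa_p(B):=\|B\|_p\,\|B^{-1}\|_p$, where $\|\cdot\|_\infty$ is the maximal absolute row sum and $\|\cdot\|_1$ the maximal absolute column sum. Then: (i) $|A^{-1}|$ and $|C^{-1}|$ both dominate $M^{-1}$. (ii) All complex eigenvalues of $M$, $A$ and $C$ are real, and the minimal eigenvalues of $A$ and of $C$ are both at most the minimal eigenvalue of $M$. (iii) The minimal singular values of $A$ and of $C$ are both at most the minimal singular value of $M$. (iv) $\kappa_\infty(M)\le\kappa_\infty(A)$ and $\kappa_1(M)\le\kappa_1(C)$. -/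

import Mathlib

namespace TPCond

variable {n : ℕ}

/-- A square real matrix is *totally positive* (TP) if all its minors are nonnegative: a minor of
order `k` is the determinant of the submatrix on `k` rows and `k` columns, taken in increasing
order. -/
def IsTP (A : Matrix (Fin n) (Fin n) ℝ) : Prop :=
  ∀ (k : ℕ) (r c : Fin k ↪o Fin n), 0 ≤ (A.submatrix r c).det

/-- The matrix `|A|` of absolute values of the entries of `A`. -/
def absMatrix (A : Matrix (Fin n) (Fin n) ℝ) : Matrix (Fin n) (Fin n) ℝ :=
  A.map fun x => |x|

/-- `B` *dominates* `D`: `B` is nonnegative and `|D| ≤ B` entrywise. -/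
def Dominates (B D : Matrix (Fin n) (Fin n) ℝ) : Prop :=
  (∀ i j, 0 ≤ B i j) ∧ ∀ i j, absMatrix D i j ≤ B i j

/-- `m` is the minimal eigenvalue of the real matrix `A`: it is an eigenvalue of `A`, and every
complex eigenvalue of `A` is a real number that is at least `m`. -/
def IsMinEigenvalue (A : Matrix (Fin n) (Fin n) ℝ) (m : ℝ) : Prop :=
  (m : ℂ) ∈ spectrum ℂ (A.map Complex.ofReal) ∧
    ∀ z ∈ spectrum ℂ (A.map Complex.ofReal), ∃ x : ℝ, z = (x : ℂ) ∧ m ≤ x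

/-- The minimal singular value of an `n × n` matrix, the least of its `n` singular values
(meaningful for `0 < n`). -/
noncomputable def minSingularValue (A : Matrix (Fin n) (Fin n) ℝ) : ℝ :=
  ⨅ i : Fin n, (Matrix.toEuclideanLin A).singularValues (i : ℕ)

/-- The matrix norm induced by the vector `∞`-norm: the maximal absolute row sum. -/
noncomputable def normInf (A : Matrix (Fin n) (Fin n) ℝ) : ℝ :=
  ⨆ i : Fin n, ∑ j : Fin n, |A i j|

/-- The matrix norm induced by the vector `1`-norm: the maximal absolute column sum. -/
noncomputable def normOne (A : Matrix (Fin n) (Fin n) ℝ) : ℝ :=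
  ⨆ j : Fin n, ∑ i : Fin n, |A i j|

/-- The condition number `κ_∞(A)` of a nonsingular matrix. -/
noncomputable def condInf (A : Matrix (Fin n) (Fin n) ℝ) : ℝ :=
  normInf A * normInf A⁻¹

/-- The condition number `κ_1(A)` of a nonsingular matrix. -/
noncomputable def condOne (A : Matrix (Fin n) (Fin n) ℝ) : ℝ :=
  normOne A * normOne A⁻¹

end TPCond

/-!
A nonsingular totally positive matrix `A` has an inverse with checkerboard signs, so
`|A⁻¹| = D A⁻¹ D` with `D = diag(1, -1, 1, …)`, and `|(MK)⁻¹| = |K⁻¹| |M⁻¹|`. The diagonal entries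
of `|K⁻¹|` are the quotients `det K(i|i) / det K`, where `K(i|i)` omits row and column `i`. By the
Hadamard–Fischer inequality `det K ≤ k_ii det K(i|i)` (`IsTP.det_le_mul_det_submatrix`, proved by
induction through the Schur complement of the top left entry) they are at least `1` when
`k_ii ≤ 1`. Hence `|(MK)⁻¹|` dominates `M⁻¹`, and likewise `|(Kᵀ M)⁻¹|`. The other claims follow from
this domination.

* The eigenvalues of a nonsingular totally positive matrix are positive (`IsTP.eigenvalue_pos`). Its
  compound matrices are nonnegative, and the same inequality makes their diagonals positive. For
  a nonnegative matrix with positive diagonal, every eigenvalue of maximal modulus is positive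
  (`eigenvalue_pos_of_forall_norm_le`); no strict positivity or approximation is needed. The
  eigenvalues of the `k`-th compound are the products of `k` eigenvalues
  (`mem_spectrum_compound_iff`, from Cauchy–Binet and triangularization over `ℂ`), so each eigenvalue
  is a quotient of two positive products. The minimal eigenvalue is therefore the reciprocal of the
  spectral radius of `|A⁻¹|`, which is monotone in `|A⁻¹|`; monotonicity is used in the form of
  `exists_eigenvalue_of_smul_le_mulVec`, a consequence of Gelfand's formula.
* For singular values, a minimizing vector `v` of `M` is compared with `D |A⁻¹| |M v|`, which is at
  least as long and has an image under `A` as long as `M v`.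
* Multiplying by a stochastic matrix on the right preserves the row sums of a nonnegative matrix, so
  the condition numbers differ only in the norms of the inverses.
-/

namespace TPCond

open Matrix Finset

/-! ### Minors of products and compound matrices -/

/-- Every injective map `Fin k → Fin n` is, in exactly one way, a permutation followed by an
increasing map. -/
theorem orderEmb_comp_perm_bijective (k n : ℕ) :
    Function.Bijective (fun x : (Fin k ↪o Fin n) × Equiv.Perm (Fin k) =>
      (⟨x.1 ∘ x.2, x.1.injective.comp x.2.injective⟩ :
        {p : Fin k → Fin n // Function.Injective p})) := by
  constructor
  · rintro ⟨S, σ⟩ ⟨R, τ⟩ h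
    have h' : (S : Fin k → Fin n) ∘ σ = R ∘ τ := congrArg Subtype.val h
    have hr : Set.range S = Set.range R := by
      have := congrArg Set.range h'
      rwa [σ.surjective.range_comp, τ.surjective.range_comp] at this
    have hSR : S = R := by
      apply DFunLike.coe_injective
      exact (S.strictMono.range_inj R.strictMono).1 hr
    subst hSR
    have : σ = τ := by
      ext i
      have := congrFun h' i
      exact congrArg Fin.val (S.injective this)
    rw [this]
  · rintro ⟨p, hp⟩
    have hc : (univ.image p).card = k := by
      rw [card_image_of_injective _ hp]; simp
    let S := (univ.image p).orderEmbOfFin hc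
    have hS : ∀ i, ∃ j, S j = p i := by
      intro i
      have : p i ∈ Set.range S := by
        rw [range_orderEmbOfFin]; simp
      exact this
    choose σ hσ using hS
    have hinj : Function.Injective σ := fun i j h => hp (by rw [← hσ i, ← hσ j, h])
    refine ⟨⟨S, Equiv.ofBijective σ (Finite.injective_iff_bijective.1 hinj)⟩, ?_⟩
    apply Subtype.ext
    funext i
    exact hσ i

variable {R : Type*} [CommRing R]

/-- The Cauchy–Binet formula. -/
theorem det_mul_eq_sum_minors {k n : ℕ} (A : Matrix (Fin k) (Fin n) R)
    (B : Matrix (Fin n) (Fin k) R) :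
    (A * B).det = ∑ S : Fin k ↪o Fin n, (A.submatrix id S).det * (B.submatrix S id).det := by
  have h1 : (A * B).det = ∑ p : Fin k → Fin n, (A.submatrix id p).det * ∏ i, B (p i) i := by
    simp only [det_apply', mul_apply, prod_univ_sum, Fintype.piFinset_univ, mul_sum, sum_mul]
    rw [sum_comm]
    simp only [prod_mul_distrib, submatrix_apply, id, mul_assoc]
  have h2 : ∑ p : Fin k → Fin n, (A.submatrix id p).det * ∏ i, B (p i) i
      = ∑ p : {p : Fin k → Fin n // Function.Injective p},
        (A.submatrix id p.1).det * ∏ i, B (p.1 i) i := by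
    rw [← Finset.sum_subtype (univ.filter Function.Injective) (fun p => by simp)
      (fun p : Fin k → Fin n => (A.submatrix id p).det * ∏ i, B (p i) i)]
    symm
    apply Finset.sum_filter_of_ne
    intro p _ hne
    by_contra hp
    simp only [Function.Injective, not_forall] at hp
    obtain ⟨i, j, hij, hne'⟩ := hp
    apply hne
    rw [det_zero_of_column_eq hne' (fun l => by simp [hij]), zero_mul]
  rw [h1, h2, ← (orderEmb_comp_perm_bijective k n).sum_comp, Fintype.sum_prod_type]
  refine sum_congr rfl fun S _ => ?_
  have h3 : ∀ σ : Equiv.Perm (Fin k), (A.submatrix id (S ∘ σ)).det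
      = ((Equiv.Perm.sign σ : ℤ) : R) * (A.submatrix id S).det := by
    intro σ
    exact det_permute' σ (A.submatrix id S)
  simp only [h3]
  rw [det_apply' (B.submatrix S id), mul_sum]
  refine sum_congr rfl fun σ _ => ?_
  simp only [Function.comp, submatrix_apply, id]
  ring

/-- The `k`-th compound matrix: its entries are the minors of order `k`, indexed by the increasing
choices of `k` rows and `k` columns. -/
def compound (k : ℕ) {n : ℕ} (A : Matrix (Fin n) (Fin n) R) :
    Matrix (Fin k ↪o Fin n) (Fin k ↪o Fin n) R :=
  Matrix.of fun S T => (A.submatrix S T).det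

theorem compound_apply (k : ℕ) {n : ℕ} (A : Matrix (Fin n) (Fin n) R) (S T : Fin k ↪o Fin n) :
    compound k A S T = (A.submatrix S T).det := rfl

theorem compound_mul (k : ℕ) {n : ℕ} (A B : Matrix (Fin n) (Fin n) R) :
    compound k (A * B) = compound k A * compound k B := by
  ext S T
  rw [mul_apply, compound_apply]
  have : (A * B).submatrix S T = A.submatrix S id * B.submatrix id T :=
    submatrix_mul A B S id T Function.bijective_id
  rw [this, det_mul_eq_sum_minors]
  rfl

theorem compound_map {R' : Type*} [CommRing R'] (f : R →+* R') (k : ℕ) {n : ℕ}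
    (A : Matrix (Fin n) (Fin n) R) : compound k (A.map f) = (compound k A).map f := by
  ext S T
  rw [map_apply, compound_apply, compound_apply, RingHom.map_det]
  rfl

/-- A nonzero minor of an upper triangular matrix has its rows weakly before its columns. -/
theorem le_of_minor_ne_zero {k n : ℕ} {T : Matrix (Fin n) (Fin n) R}
    (hT : ∀ i j, j < i → T i j = 0) {S U : Fin k ↪o Fin n} (h : (T.submatrix S U).det ≠ 0)
    (j : Fin k) : S j ≤ U j := by
  rw [det_apply'] at h
  obtain ⟨σ, -, hσ⟩ := exists_ne_zero_of_sum_ne_zero h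
  have hle : ∀ i, S (σ i) ≤ U i := by
    intro i
    by_contra hlt
    apply hσ
    rw [prod_eq_zero (mem_univ i), mul_zero]
    exact hT _ _ (not_le.1 hlt)
  -- by cardinality, `σ` sends some index `≤ j` to an index `≥ j`
  obtain ⟨i, hij, hji⟩ : ∃ i ≤ j, j ≤ σ i := by
    by_contra! hcon
    have hsub : (Iic j).image σ ⊆ Iio j := by
      intro x hx
      obtain ⟨i, hi, rfl⟩ := mem_image.1 hx
      exact mem_Iio.2 (hcon i (mem_Iic.1 hi))
    have := card_le_card hsub
    rw [card_image_of_injective _ σ.injective, Fin.card_Iic, Fin.card_Iio] at this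
    omega
  exact (S.monotone hji).trans ((hle i).trans (U.monotone hij))

theorem compound_one (k n : ℕ) : compound k (1 : Matrix (Fin n) (Fin n) R) = 1 := by
  ext S U
  rw [compound_apply]
  by_cases hSU : S = U
  · subst hSU
    rw [one_apply_eq, submatrix_one _ S.injective, det_one]
  · rw [one_apply_ne hSU]
    by_contra h
    have hlow : ∀ i j : Fin n, j < i → (1 : Matrix (Fin n) (Fin n) R) i j = 0 :=
      fun i j hij => one_apply_ne hij.ne'
    have h' : ((1 : Matrix (Fin n) (Fin n) R).submatrix U S).det ≠ 0 := by
      rw [← det_transpose, transpose_submatrix, transpose_one]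
      exact h
    refine hSU (RelEmbedding.ext fun j => le_antisymm ?_ ?_)
    · exact le_of_minor_ne_zero hlow h j
    · exact le_of_minor_ne_zero hlow h' j

/-! ### Triangularization over `ℂ` and the spectrum of a compound matrix -/

theorem mem_spectrum_iff_det {K ι : Type*} [Field K] [Fintype ι] [DecidableEq ι]
    (A : Matrix ι ι K) (z : K) : z ∈ spectrum K A ↔ (z • (1 : Matrix ι ι K) - A).det = 0 := by
  rw [spectrum.mem_iff, Matrix.isUnit_iff_isUnit_det, isUnit_iff_ne_zero, not_not,
    Algebra.algebraMap_eq_smul_one]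

theorem mem_spectrum_iff_exists_mulVec {K ι : Type*} [Field K] [Fintype ι] [DecidableEq ι]
    (A : Matrix ι ι K) (z : K) : z ∈ spectrum K A ↔ ∃ v ≠ 0, A *ᵥ v = z • v := by
  rw [mem_spectrum_iff_det, ← exists_mulVec_eq_zero_iff]
  refine exists_congr fun v => and_congr_right fun _ => ?_
  rw [sub_mulVec, smul_mulVec, one_mulVec, sub_eq_zero, eq_comm]

/-- Every complex matrix is similar to an upper triangular one. -/
theorem exists_upperTriangular (n : ℕ) (M : Matrix (Fin n) (Fin n) ℂ) :
    ∃ P T : Matrix (Fin n) (Fin n) ℂ, P.det ≠ 0 ∧ (∀ i j, j < i → T i j = 0) ∧ M * P = P * T := by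
  induction n with
  | zero => exact ⟨1, M, by simp, fun i => i.elim0, by simp⟩
  | succ n ih =>
    obtain ⟨z, hz⟩ := spectrum.nonempty_of_isAlgClosed_of_finiteDimensional ℂ M
    obtain ⟨v, hv, hMv⟩ := (mem_spectrum_iff_exists_mulVec M z).1 hz
    obtain ⟨l, hl⟩ : ∃ l, v l ≠ 0 := Function.ne_iff.1 hv
    -- an invertible matrix whose first column is the eigenvector `v`
    let Q : Matrix (Fin (n + 1)) (Fin (n + 1)) ℂ :=
      ((1 : Matrix (Fin (n + 1)) (Fin (n + 1)) ℂ).updateCol l v).submatrix id (Equiv.swap 0 l)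
    have hQdet : Q.det ≠ 0 := by
      have h1 : ((1 : Matrix (Fin (n + 1)) (Fin (n + 1)) ℂ).updateCol l v).det = v l := by
        rw [← cramer_apply, cramer_one]; rfl
      rw [show Q.det = _ from det_permute' _ _, h1]
      exact mul_ne_zero (by simp) hl
    have hQ : IsUnit Q.det := isUnit_iff_ne_zero.2 hQdet
    have hQ0 : Q.col 0 = v := by
      funext i
      simp [Q, Matrix.col]
    obtain ⟨N, hN⟩ : ∃ N, N = Q⁻¹ * M * Q := ⟨_, rfl⟩
    have hMQ : M * Q = Q * N := by
      rw [hN, ← Matrix.mul_assoc, ← Matrix.mul_assoc, mul_nonsing_inv _ hQ, Matrix.one_mul]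
    have hN0 : ∀ i : Fin n, N i.succ 0 = 0 := by
      have h1 : N.col 0 = z • Pi.single 0 1 := by
        have e : Q *ᵥ Pi.single 0 1 = v := by rw [mulVec_single_one]; exact hQ0
        calc N.col 0 = N *ᵥ Pi.single 0 1 := (mulVec_single_one _ _).symm
          _ = Q⁻¹ *ᵥ (M *ᵥ v) := by
            rw [hN, ← mulVec_mulVec, ← mulVec_mulVec, e]
          _ = z • (Q⁻¹ *ᵥ (Q *ᵥ Pi.single 0 1)) := by rw [hMv, mulVec_smul, e]
          _ = z • Pi.single 0 1 := by
            rw [mulVec_mulVec, nonsing_inv_mul _ hQ, one_mulVec]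
      intro i
      have := congrFun h1 i.succ
      simpa using this
    obtain ⟨P', T', hP', hT', h'⟩ := ih (N.submatrix Fin.succ Fin.succ)
    let P'' : Matrix (Fin (n + 1)) (Fin (n + 1)) ℂ :=
      Matrix.of (Fin.cons (Fin.cons 1 0) fun i => Fin.cons 0 (P' i))
    let T : Matrix (Fin (n + 1)) (Fin (n + 1)) ℂ :=
      Matrix.of (Fin.cons (Fin.cons (N 0 0) fun j => ∑ l : Fin n, N 0 l.succ * P' l j)
        fun i => Fin.cons 0 (T' i))
    refine ⟨Q * P'', T, ?_, ?_, ?_⟩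
    · rw [det_mul]
      refine mul_ne_zero hQdet ?_
      have : P''.det = P'.det := by
        rw [det_succ_row_zero, Fin.sum_univ_succ]
        simp only [P'']
        simp
        rfl
      rwa [this]
    · intro i j hij
      induction i using Fin.cases with
      | zero => exact absurd hij (Fin.not_lt_zero j)
      | succ i =>
        induction j using Fin.cases with
        | zero => rfl
        | succ j => exact hT' i j (Fin.succ_lt_succ_iff.1 hij)
    · rw [← Matrix.mul_assoc, hMQ, Matrix.mul_assoc, Matrix.mul_assoc]
      refine congrArg (Q * ·) ?_
      ext i j
      rw [mul_apply, mul_apply, Fin.sum_univ_succ, Fin.sum_univ_succ]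
      induction i using Fin.cases with
      | zero =>
        induction j using Fin.cases with
        | zero => simp [P'', T]
        | succ j => simp [P'', T]
      | succ i =>
        induction j using Fin.cases with
        | zero => simp [P'', T, hN0]
        | succ j =>
          have := congrFun (congrFun h' i) j
          simp only [mul_apply, submatrix_apply] at this
          simp [P'', T, this]

theorem det_smul_one_sub_eq_of_mul_eq {K ι : Type*} [Field K] [Fintype ι] [DecidableEq ι]
    {M P T : Matrix ι ι K} (hP : P.det ≠ 0) (h : M * P = P * T) (z : K) :
    (z • (1 : Matrix ι ι K) - M).det = (z • (1 : Matrix ι ι K) - T).det := by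
  have : (z • 1 - M) * P = P * (z • 1 - T) := by
    rw [Matrix.sub_mul, Matrix.mul_sub, h]
    simp
  have := congrArg det this
  rw [det_mul, det_mul, mul_comm] at this
  exact mul_left_cancel₀ hP this

theorem det_eq_prod_diag_of_injective {K ι α : Type*} [CommRing K] [Fintype ι] [DecidableEq ι]
    [LinearOrder α] {f : ι → α} (hf : Function.Injective f) {A : Matrix ι ι K}
    (hA : ∀ i j, f j < f i → A i j = 0) : A.det = ∏ i, A i i := by
  let _ : LinearOrder ι := LinearOrder.lift' f hf
  have h : A.IsUpperTriangular := fun i j hij => hA i j hij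
  convert! det_of_isUpperTriangular h

/-- If `M` is similar to the upper triangular matrix `T`, the eigenvalues of its `k`-th compound are
the products of `k` diagonal entries of `T`. -/
theorem mem_spectrum_compound_iff {n : ℕ} {M P T : Matrix (Fin n) (Fin n) ℂ} (hP : P.det ≠ 0)
    (hT : ∀ i j, j < i → T i j = 0) (h : M * P = P * T) (k : ℕ) (z : ℂ) :
    z ∈ spectrum ℂ (compound k M) ↔ ∃ S : Fin k ↪o Fin n, z = ∏ i, T (S i) (S i) := by
  have hPP : compound k P * compound k P⁻¹ = 1 := by
    rw [← compound_mul, mul_nonsing_inv _ (isUnit_iff_ne_zero.2 hP), compound_one]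
  have hdetP : (compound k P).det ≠ 0 := by
    intro h0
    have := congrArg det hPP
    rw [det_mul, h0, zero_mul, det_one] at this
    exact zero_ne_one this
  have hsim : compound k M * compound k P = compound k P * compound k T := by
    rw [← compound_mul, ← compound_mul, h]
  -- `compound k T` is upper triangular for the lexicographic order
  have htri : ∀ S U : Fin k ↪o Fin n, toLex (U : Fin k → Fin n) < toLex (S : Fin k → Fin n) →
      (z • 1 - compound k T) S U = 0 := by
    intro S U hUS
    have hne : S ≠ U := fun e => absurd hUS (by rw [e]; exact lt_irrefl _)
    rw [Matrix.sub_apply, Matrix.smul_apply, one_apply_ne hne, smul_zero, zero_sub, neg_eq_zero]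
    by_contra hcon
    have hle : (S : Fin k → Fin n) ≤ U := fun j => le_of_minor_ne_zero hT hcon j
    exact absurd hUS (not_lt.2 (Pi.toLex_monotone hle))
  have hdiag : ∀ S : Fin k ↪o Fin n, compound k T S S = ∏ i, T (S i) (S i) := by
    intro S
    rw [compound_apply, det_of_isUpperTriangular]
    · rfl
    · intro i j hji
      exact hT _ _ (S.strictMono hji)
  rw [mem_spectrum_iff_det, det_smul_one_sub_eq_of_mul_eq hdetP hsim,
    det_eq_prod_diag_of_injective
    (f := fun S : Fin k ↪o Fin n => toLex (S : Fin k → Fin n))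
    (fun S U hSU => DFunLike.coe_injective (toLex.injective hSU)) htri, prod_eq_zero_iff]
  simp [sub_eq_zero, hdiag]

variable {n : ℕ}

/-! ### Minors of totally positive matrices -/

theorem IsTP.det_nonneg_of_strictMono {A : Matrix (Fin n) (Fin n) ℝ} (hA : IsTP A) {k : ℕ}
    {r c : Fin k → Fin n} (hr : StrictMono r) (hc : StrictMono c) :
    0 ≤ (A.submatrix r c).det :=
  hA k (OrderEmbedding.ofStrictMono r hr) (OrderEmbedding.ofStrictMono c hc)

theorem IsTP.det_nonneg {A : Matrix (Fin n) (Fin n) ℝ} (hA : IsTP A) : 0 ≤ A.det :=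
  hA.det_nonneg_of_strictMono strictMono_id strictMono_id

theorem IsTP.det_pos {A : Matrix (Fin n) (Fin n) ℝ} (hA : IsTP A) (h : IsUnit A.det) : 0 < A.det :=
  lt_of_le_of_ne hA.det_nonneg h.ne_zero.symm

theorem IsTP.apply_nonneg {A : Matrix (Fin n) (Fin n) ℝ} (hA : IsTP A) (i j : Fin n) :
    0 ≤ A i j := by
  have := hA.det_nonneg_of_strictMono (k := 1) (r := fun _ => i) (c := fun _ => j)
    (Subsingleton.strictMono _) (Subsingleton.strictMono _)
  simpa using this

theorem IsTP.submatrix {m : ℕ} {A : Matrix (Fin n) (Fin n) ℝ} (hA : IsTP A)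
    (r c : Fin m ↪o Fin n) : IsTP (A.submatrix r c) := fun _ r' c' =>
  hA.det_nonneg_of_strictMono (r.strictMono.comp r'.strictMono) (c.strictMono.comp c'.strictMono)

theorem IsTP.mul {A B : Matrix (Fin n) (Fin n) ℝ} (hA : IsTP A) (hB : IsTP B) : IsTP (A * B) := by
  intro k r c
  rw [← compound_apply, compound_mul, mul_apply]
  exact sum_nonneg fun S _ => mul_nonneg (hA k r S) (hB k S c)

theorem IsTP.transpose {A : Matrix (Fin n) (Fin n) ℝ} (hA : IsTP A) : IsTP Aᵀ := by
  intro k r c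
  rw [← transpose_submatrix, det_transpose]
  exact hA k c r

/-- Reversing the order of both rows and columns preserves total positivity. -/
theorem IsTP.rev {A : Matrix (Fin n) (Fin n) ℝ} (hA : IsTP A) :
    IsTP (A.submatrix Fin.rev Fin.rev) := by
  intro k r c
  have h : ∀ r : Fin k ↪o Fin n, StrictMono (fun i : Fin k => (r i.rev).rev) := by
    intro r i j hij
    exact Fin.rev_lt_rev.2 (r.strictMono (Fin.rev_lt_rev.2 hij))
  have := hA.det_nonneg_of_strictMono (h r) (h c)
  rw [← det_submatrix_equiv_self Fin.revPerm] at this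
  convert this using 2
  ext i j
  simp

/-- The Schur complement of the top left entry. -/
noncomputable def schurComplement (A : Matrix (Fin (n + 1)) (Fin (n + 1)) ℝ) :
    Matrix (Fin n) (Fin n) ℝ :=
  Matrix.of fun i j => A i.succ j.succ - A i.succ 0 * A 0 j.succ / A 0 0

theorem det_eq_mul_det_schurComplement (A : Matrix (Fin (n + 1)) (Fin (n + 1)) ℝ)
    (h : A 0 0 ≠ 0) : A.det = A 0 0 * (schurComplement A).det := by
  let c : Fin (n + 1) → ℝ := Fin.cons 0 fun i => A i.succ 0 / A 0 0
  let B : Matrix (Fin (n + 1)) (Fin (n + 1)) ℝ := Matrix.of fun i j => A i j - c i * A 0 j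
  have hB : A.det = B.det := by
    refine det_eq_of_forall_row_eq_smul_add_const c 0 rfl fun i j => ?_
    simp [B, c]
  rw [hB, det_succ_column_zero, Fin.sum_univ_succ]
  have h0 : ∀ i : Fin n, B i.succ 0 = 0 := by
    intro i
    simp [B, c, h]
  have h00 : B 0 0 = A 0 0 := by simp [B, c]
  have hS : B.submatrix Fin.succ Fin.succ = schurComplement A := by
    ext i j
    simp [B, c, schurComplement]
    ring
  simp [h0, h00, hS]

/-- A minor of the Schur complement is, up to the pivot, the minor of `A` bordered by the first row
and column. -/
theorem det_bordered_eq {k : ℕ} (A : Matrix (Fin (n + 1)) (Fin (n + 1)) ℝ) (h : A 0 0 ≠ 0)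
    (r c : Fin k → Fin n) :
    (A.submatrix (Fin.cons 0 fun i => (r i).succ : Fin (k + 1) → Fin (n + 1))
      (Fin.cons 0 fun i => (c i).succ : Fin (k + 1) → Fin (n + 1))).det
      = A 0 0 * ((schurComplement A).submatrix r c).det := by
  rw [det_eq_mul_det_schurComplement _ (by simpa using h)]
  rfl

theorem strictMono_cons_succ {k : ℕ} {r : Fin k → Fin n} (hr : StrictMono r) :
    StrictMono (Fin.cons 0 fun i => (r i).succ : Fin (k + 1) → Fin (n + 1)) := by
  intro i j hij
  induction j using Fin.cases with
  | zero => exact absurd hij (Fin.not_lt_zero i)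
  | succ j =>
    induction i using Fin.cases with
    | zero => exact Fin.succ_pos _
    | succ i => exact Fin.succ_lt_succ_iff.2 (hr (Fin.succ_lt_succ_iff.1 hij))

theorem IsTP.schurComplement {A : Matrix (Fin (n + 1)) (Fin (n + 1)) ℝ} (hA : IsTP A)
    (h : 0 < A 0 0) : IsTP (schurComplement A) := by
  intro k r c
  have h1 := hA.det_nonneg_of_strictMono (strictMono_cons_succ r.strictMono)
    (strictMono_cons_succ c.strictMono)
  rw [det_bordered_eq A h.ne'] at h1
  exact nonneg_of_mul_nonneg_right h1 h

/-- If the top left entry of a totally positive matrix vanishes, so does its first row or its first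
column, by the `2 × 2` minors. -/
theorem IsTP.det_eq_zero_of_apply_zero_eq_zero {A : Matrix (Fin (n + 1)) (Fin (n + 1)) ℝ}
    (hA : IsTP A) (h : A 0 0 = 0) : A.det = 0 := by
  by_cases hrow : ∀ j, A 0 j = 0
  · exact det_eq_zero_of_row_eq_zero 0 hrow
  push Not at hrow
  obtain ⟨j, hj⟩ := hrow
  refine det_eq_zero_of_column_eq_zero 0 fun i => ?_
  have hj0 : (0 : Fin (n + 1)) < j := Fin.pos_of_ne_zero (fun e => hj (e ▸ h))
  rcases (Fin.zero_le i).eq_or_lt with rfl | hi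
  · exact h
  have hm := hA.det_nonneg_of_strictMono (k := 2) (r := ![0, i]) (c := ![0, j])
    (by simpa [Fin.strictMono_iff_lt_succ] using hi) (by simpa [Fin.strictMono_iff_lt_succ] using hj0)
  rw [det_fin_two] at hm
  simp [h] at hm
  have hj' : 0 < A 0 j := lt_of_le_of_ne (hA.apply_nonneg _ _) hj.symm
  have := hA.apply_nonneg i 0
  nlinarith

/-- The Hadamard–Fischer inequality for totally positive matrices, splitting off one index. -/
theorem IsTP.det_le_mul_det_submatrix (n : ℕ) {A : Matrix (Fin (n + 1)) (Fin (n + 1)) ℝ}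
    (hA : IsTP A) (i : Fin (n + 1)) :
    A.det ≤ A i i * (A.submatrix i.succAbove i.succAbove).det := by
  induction n with
  | zero =>
    obtain rfl : i = 0 := Subsingleton.elim (α := Fin 1) i 0
    have h1 : (A.submatrix (Fin.succAbove 0) (Fin.succAbove 0)).det = 1 := det_fin_zero
    rw [h1, mul_one]
    exact (det_fin_one A).le
  | succ n ih =>
    have key : ∀ {A : Matrix (Fin (n + 1 + 1)) (Fin (n + 1 + 1)) ℝ} (hA : IsTP A)
        (j : Fin (n + 1)),
        A.det ≤ A j.succ j.succ * (A.submatrix j.succ.succAbove j.succ.succAbove).det := by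
      intro A hA j
      have hmin : 0 ≤ (A.submatrix j.succ.succAbove j.succ.succAbove).det :=
        hA.det_nonneg_of_strictMono (Fin.strictMono_succAbove _) (Fin.strictMono_succAbove _)
      rcases (hA.apply_nonneg 0 0).eq_or_lt with h0 | h0
      · rw [hA.det_eq_zero_of_apply_zero_eq_zero h0.symm]
        exact mul_nonneg (hA.apply_nonneg _ _) hmin
      have hsub : (A.submatrix j.succ.succAbove j.succ.succAbove).det
          = A 0 0 * ((TPCond.schurComplement A).submatrix j.succAbove j.succAbove).det := by
        rw [← det_bordered_eq A h0.ne']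
        have : j.succ.succAbove
            = (Fin.cons 0 fun l => (j.succAbove l).succ : Fin (n + 1) → Fin (n + 1 + 1)) := by
          funext l
          induction l using Fin.cases with
          | zero => simp
          | succ l => simp
        rw [this]
      have hle : TPCond.schurComplement A j j ≤ A j.succ j.succ :=
        sub_le_self _ (div_nonneg (mul_nonneg (hA.apply_nonneg _ _) (hA.apply_nonneg _ _)) h0.le)
      calc A.det = A 0 0 * (TPCond.schurComplement A).det :=
            det_eq_mul_det_schurComplement A h0.ne'
        _ ≤ A 0 0 * (TPCond.schurComplement A j j *
              ((TPCond.schurComplement A).submatrix j.succAbove j.succAbove).det) :=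
            mul_le_mul_of_nonneg_left (ih (hA.schurComplement h0) j) h0.le
        _ = TPCond.schurComplement A j j *
              (A.submatrix j.succ.succAbove j.succ.succAbove).det := by rw [hsub]; ring
        _ ≤ _ := mul_le_mul_of_nonneg_right hle hmin
    induction i using Fin.cases with
    | succ j => exact key hA j
    | zero =>
      -- the first index becomes the last one after reversing the order
      have h := key hA.rev (Fin.last n)
      have e : ((A.submatrix Fin.rev Fin.rev).submatrix (Fin.last n).succ.succAbove
          (Fin.last n).succ.succAbove).det
          = (A.submatrix (Fin.succAbove 0) (Fin.succAbove 0)).det := by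
        rw [← det_submatrix_equiv_self Fin.revPerm
          (A.submatrix (Fin.succAbove 0) (Fin.succAbove 0))]
        congr 1
        ext a b
        simp [Fin.rev_castSucc]
      rw [e] at h
      have e' : (A.submatrix Fin.rev Fin.rev).det = A.det :=
        det_submatrix_equiv_self Fin.revPerm A
      rw [e'] at h
      simpa using h

/-- The principal minors of a nonsingular totally positive matrix are positive. -/
theorem IsTP.principal_minor_pos {A : Matrix (Fin n) (Fin n) ℝ} (hA : IsTP A) (h : 0 < A.det)
    {k : ℕ} (S : Fin k ↪o Fin n) : 0 < (A.submatrix S S).det := by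
  induction n with
  | zero =>
    have : IsEmpty (Fin k) := ⟨fun i => (S i).elim0⟩
    rw [det_isEmpty]; exact one_pos
  | succ n ih =>
    by_cases hS : Function.Surjective S
    · have hk : (Equiv.ofBijective S ⟨S.injective, hS⟩ : Fin k → Fin (n + 1)) = S := rfl
      rw [← hk, det_submatrix_equiv_self]
      exact h
    · simp only [Function.Surjective, not_forall, not_exists] at hS
      obtain ⟨i, hi⟩ := hS
      have hpos : 0 < (A.submatrix i.succAbove i.succAbove).det := by
        have := h.trans_le (hA.det_le_mul_det_submatrix n i)
        exact pos_of_mul_pos_right this (hA.apply_nonneg i i)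
      choose S' hS' using fun j => Fin.exists_succAbove_eq (hi j)
      have hmono : StrictMono S' := by
        intro a b hab
        rw [← (Fin.strictMono_succAbove i).lt_iff_lt, hS', hS']
        exact S.strictMono hab
      have := ih (hA.submatrix (Fin.succAboveOrderEmb i) (Fin.succAboveOrderEmb i)) hpos
        (OrderEmbedding.ofStrictMono S' hmono)
      convert this using 2
      ext a b
      simp [hS']

/-! ### Inverses of totally positive matrices -/

/-- The diagonal matrix with alternating diagonal entries `1, -1, 1, …`. -/
def altSign (n : ℕ) : Matrix (Fin n) (Fin n) ℝ := diagonal fun i => (-1) ^ (i : ℕ)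

theorem altSign_mul_self (n : ℕ) : altSign n * altSign n = 1 := by
  rw [altSign, diagonal_mul_diagonal, ← diagonal_one]
  congr 1
  funext i
  rw [← pow_add, Even.neg_one_pow ⟨_, rfl⟩]

/-- The inverse of a totally positive matrix has checkerboard signs. -/
theorem IsTP.absMatrix_inv {A : Matrix (Fin n) (Fin n) ℝ} (hA : IsTP A) :
    absMatrix A⁻¹ = altSign n * A⁻¹ * altSign n := by
  ext i j
  rw [altSign, mul_diagonal, diagonal_mul, absMatrix, map_apply]
  cases n with
  | zero => exact i.elim0
  | succ n =>
    rw [Matrix.inv_def, Matrix.smul_apply, adjugate_fin_succ_eq_det_submatrix, smul_eq_mul,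
      Ring.inverse_eq_inv]
    have h1 : 0 ≤ (A.submatrix j.succAbove i.succAbove).det :=
      hA.det_nonneg_of_strictMono (Fin.strictMono_succAbove _) (Fin.strictMono_succAbove _)
    have h2 : 0 ≤ A.det⁻¹ := inv_nonneg.2 hA.det_nonneg
    rw [abs_mul, abs_mul, abs_of_nonneg h1, abs_of_nonneg h2, abs_pow, abs_neg, abs_one, one_pow]
    have h3 : ((-1 : ℝ) ^ (i : ℕ)) * (-1) ^ (i : ℕ) = 1 := by
      rw [← pow_add, Even.neg_one_pow ⟨_, rfl⟩]
    have h4 : ((-1 : ℝ) ^ (j : ℕ)) * (-1) ^ (j : ℕ) = 1 := by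
      rw [← pow_add, Even.neg_one_pow ⟨_, rfl⟩]
    rw [pow_add]
    linear_combination (-(A.det⁻¹ * (A.submatrix j.succAbove i.succAbove).det)) *
      (((-1 : ℝ) ^ (j : ℕ)) * (-1) ^ (j : ℕ) * h3 + h4)

/-- For totally positive matrices, `|(AB)⁻¹| = |B⁻¹| |A⁻¹|`. -/
theorem IsTP.absMatrix_mul_inv {A B : Matrix (Fin n) (Fin n) ℝ} (hA : IsTP A) (hB : IsTP B) :
    absMatrix (A * B)⁻¹ = absMatrix B⁻¹ * absMatrix A⁻¹ := by
  rw [(hA.mul hB).absMatrix_inv, hA.absMatrix_inv, hB.absMatrix_inv, Matrix.mul_inv_rev]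
  have : ∀ X Y D : Matrix (Fin n) (Fin n) ℝ, D * D = 1 →
      D * (X * Y) * D = D * X * D * (D * Y * D) := by
    intro X Y D hD
    calc D * (X * Y) * D = D * X * (D * D) * Y * D := by
          rw [hD, Matrix.mul_one]; simp only [Matrix.mul_assoc]
      _ = _ := by simp only [Matrix.mul_assoc]
  exact this _ _ _ (altSign_mul_self n)

theorem absMatrix_nonneg (A : Matrix (Fin n) (Fin n) ℝ) (i j : Fin n) : 0 ≤ absMatrix A i j :=
  abs_nonneg _

/-- By the Hadamard–Fischer inequality, the inverse of a totally positive matrix whose diagonal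
entries are at most `1` has diagonal entries at least `1`. -/
theorem IsTP.one_le_absMatrix_inv_diag {K : Matrix (Fin n) (Fin n) ℝ} (hK : IsTP K)
    (hdet : IsUnit K.det) {i : Fin n} (hi : K i i ≤ 1) : 1 ≤ absMatrix K⁻¹ i i := by
  cases n with
  | zero => exact i.elim0
  | succ n =>
    refine le_trans ?_ (le_abs_self _)
    rw [Matrix.inv_def, Matrix.smul_apply, adjugate_fin_succ_eq_det_submatrix, smul_eq_mul,
      Ring.inverse_eq_inv, Even.neg_one_pow ⟨_, rfl⟩, one_mul, inv_mul_eq_div,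
      one_le_div (hK.det_pos hdet)]
    refine (hK.det_le_mul_det_submatrix n i).trans (mul_le_of_le_one_left ?_ hi)
    exact hK.det_nonneg_of_strictMono (Fin.strictMono_succAbove _) (Fin.strictMono_succAbove _)

/-! ### Moduli of eigenvalues of nonnegative matrices -/

section Nonneg

variable {ι : Type*} [Fintype ι] [DecidableEq ι]

open Filter Topology in
open scoped NNReal ENNReal in
/-- A nonnegative matrix `P` with `c w ≤ P w` for some nonzero `w ≥ 0` has an eigenvalue of modulus
at least `c`: the powers satisfy `c ^ k w ≤ P ^ k w`, so that Gelfand's formula applies. -/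
theorem exists_eigenvalue_of_smul_le_mulVec {P : Matrix ι ι ℝ} (hP : ∀ i j, 0 ≤ P i j)
    {w : ι → ℝ} (hw : ∀ i, 0 ≤ w i) (hw0 : w ≠ 0) {c : ℝ} (hc : 0 ≤ c)
    (h : ∀ i, c * w i ≤ (P *ᵥ w) i) :
    ∃ z ∈ spectrum ℂ (P.map Complex.ofReal), c ≤ ‖z‖ := by
  have : Nonempty ι := by
    by_contra hι
    rw [not_nonempty_iff] at hι
    exact hw0 (Subsingleton.elim _ _)
  let _ : NormedRing (Matrix ι ι ℂ) := Matrix.linftyOpNormedRing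
  let _ : NormedAlgebra ℂ (Matrix ι ι ℂ) := Matrix.linftyOpNormedAlgebra
  have : CompleteSpace (Matrix ι ι ℂ) := FiniteDimensional.complete ℂ _
  obtain ⟨z, hz, hzr⟩ := spectrum.exists_nnnorm_eq_spectralRadius (P.map Complex.ofReal)
  refine ⟨z, hz, ?_⟩
  have hpow : ∀ k : ℕ, ∀ i, c ^ k * w i ≤ (P ^ k *ᵥ w) i := by
    intro k
    induction k with
    | zero => intro i; simp
    | succ k ih =>
      intro i
      rw [pow_succ' P, ← mulVec_mulVec]
      calc c ^ (k + 1) * w i = c ^ k * (c * w i) := by ring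
        _ ≤ c ^ k * (P *ᵥ w) i := mul_le_mul_of_nonneg_left (h i) (pow_nonneg hc k)
        _ = ∑ j, P i j * (c ^ k * w j) := by
          rw [mulVec, dotProduct, mul_sum]
          exact sum_congr rfl fun j _ => by ring
        _ ≤ ∑ j, P i j * (P ^ k *ᵥ w) j :=
          sum_le_sum fun j _ => mul_le_mul_of_nonneg_left (ih j) (hP i j)
  obtain ⟨l, -, hl⟩ := exists_max_image univ w univ_nonempty
  have hlpos : 0 < w l := by
    refine lt_of_le_of_ne (hw l) fun h0 => hw0 ?_
    funext i
    exact le_antisymm ((hl i (mem_univ i)).trans_eq h0.symm) (hw i)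
  have hnorm : ∀ k : ℕ, c ^ k ≤ ‖(P.map Complex.ofReal) ^ k‖ := by
    intro k
    have e : (P.map Complex.ofReal) ^ k = (P ^ k).map Complex.ofReal :=
      (Matrix.map_pow P Complex.ofRealHom k).symm
    have hrow : ∑ j, |(P ^ k) l j| ≤ ‖(P.map Complex.ofReal) ^ k‖ := by
      rw [e, linfty_opNorm_def]
      have := le_sup (f := fun i => ∑ j, ‖((P ^ k).map Complex.ofReal) i j‖₊) (mem_univ l)
      have := NNReal.coe_le_coe.2 this
      simpa using this
    refine le_trans (le_of_mul_le_mul_right ?_ hlpos) hrow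
    calc c ^ k * w l ≤ ∑ j, (P ^ k) l j * w j := hpow k l
      _ ≤ ∑ j, |(P ^ k) l j| * w l := sum_le_sum fun j _ =>
        mul_le_mul (le_abs_self _) (hl j (mem_univ j)) (hw j) (abs_nonneg _)
      _ = (∑ j, |(P ^ k) l j|) * w l := (sum_mul _ _ _).symm
  lift c to ℝ≥0 using hc
  have hlim := spectrum.pow_nnnorm_pow_one_div_tendsto_nhds_spectralRadius (P.map Complex.ofReal)
  have hge : (c : ℝ≥0∞) ≤ spectralRadius ℂ (P.map Complex.ofReal) := by
    refine ge_of_tendsto hlim ?_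
    filter_upwards [eventually_ne_atTop 0] with k hk
    have hk' : ((c : ℝ≥0∞) ^ k) ≤ (‖(P.map Complex.ofReal) ^ k‖₊ : ℝ≥0∞) := by
      exact_mod_cast hnorm k
    calc (c : ℝ≥0∞) = ((c : ℝ≥0∞) ^ k) ^ (1 / k : ℝ) := by
          rw [← ENNReal.rpow_natCast, ← ENNReal.rpow_mul, mul_one_div_cancel (by exact_mod_cast hk),
            ENNReal.rpow_one]
      _ ≤ _ := ENNReal.rpow_le_rpow hk' (by positivity)
  rw [← hzr] at hge
  exact_mod_cast hge

/-- An eigenvalue of maximal modulus of a nonnegative matrix with positive diagonal is a positive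
real number. If `δ` bounds the diagonal from below, splitting off `δ • 1` shows that the matrix has
an eigenvalue of modulus at least `δ + |z - δ|`, whence `|z| ≥ δ + |z - δ|`. -/
theorem eigenvalue_pos_of_forall_norm_le {Q : Matrix ι ι ℝ} (hQ : ∀ i j, 0 ≤ Q i j)
    (hdiag : ∀ i, 0 < Q i i) {z : ℂ} (hz : z ∈ spectrum ℂ (Q.map Complex.ofReal))
    (hmax : ∀ y ∈ spectrum ℂ (Q.map Complex.ofReal), ‖y‖ ≤ ‖z‖) :
    ∃ x : ℝ, 0 < x ∧ z = x := by
  obtain ⟨v, hv, hQv⟩ := (mem_spectrum_iff_exists_mulVec _ z).1 hz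
  obtain ⟨l, hl⟩ : ∃ l, v l ≠ 0 := Function.ne_iff.1 hv
  have : Nonempty ι := ⟨l⟩
  obtain ⟨m, -, hm⟩ := exists_min_image univ (fun i => Q i i) univ_nonempty
  obtain ⟨δ, hδ, hδle⟩ : ∃ δ > 0, ∀ i, δ ≤ Q i i := ⟨Q m m, hdiag m, fun i => hm i (mem_univ i)⟩
  obtain ⟨y, hy, hcy⟩ := exists_eigenvalue_of_smul_le_mulVec (P := Q) hQ (w := fun i => ‖v i‖)
    (fun i => norm_nonneg _) (fun e => hl (by simpa using congrFun e l))
    (c := δ + ‖z - δ‖) (by positivity) (by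
      intro i
      have hN : (z - δ) * v i = ∑ j, ((Q i j - if j = i then δ else 0 : ℝ) : ℂ) * v j := by
        have := congrFun hQv i
        simp only [mulVec, dotProduct, map_apply, Pi.smul_apply, smul_eq_mul] at this
        rw [sub_mul, ← this]
        simp [sub_mul, sum_sub_distrib, apply_ite Complex.ofReal, ite_mul]
      have hle : ‖z - δ‖ * ‖v i‖ ≤ ∑ j, (Q i j - if j = i then δ else 0) * ‖v j‖ := by
        rw [← norm_mul, hN]
        refine (norm_sum_le _ _).trans (sum_le_sum fun j _ => ?_)
        rw [norm_mul, Complex.norm_real, Real.norm_eq_abs, abs_of_nonneg]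
        split_ifs with hji
        · subst hji; exact sub_nonneg.2 (hδle j)
        · simpa using hQ i j
      have hsum : ∑ j, (Q i j - if j = i then δ else 0) * ‖v j‖
          = (Q *ᵥ fun i => ‖v i‖) i - δ * ‖v i‖ := by
        simp [sub_mul, sum_sub_distrib, ite_mul, mulVec, dotProduct]
      rw [hsum] at hle
      linarith)
  have hz1 : ‖z - δ‖ ≤ ‖z‖ - δ := by linarith [hmax y hy]
  have hδz : δ ≤ ‖z‖ := by linarith [norm_nonneg (z - δ)]
  -- squaring turns `|z - δ| ≤ |z| - δ` into `|z| ≤ re z`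
  have hsq : ‖z - δ‖ ^ 2 ≤ (‖z‖ - δ) ^ 2 := pow_le_pow_left₀ (norm_nonneg _) hz1 2
  have e1 : ‖z - δ‖ ^ 2 = (z.re - δ) ^ 2 + z.im ^ 2 := by
    rw [Complex.sq_norm, Complex.normSq_apply]; simp; ring
  have e2 : ‖z‖ ^ 2 = z.re ^ 2 + z.im ^ 2 := by
    rw [Complex.sq_norm, Complex.normSq_apply]; ring
  have hre : ‖z‖ ≤ z.re := by
    have : δ * ‖z‖ ≤ δ * z.re := by nlinarith
    exact le_of_mul_le_mul_left this hδ
  have him : z.im = 0 := by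
    have : z.im ^ 2 ≤ 0 := by nlinarith [norm_nonneg z]
    exact pow_eq_zero_iff (two_ne_zero) |>.1 (le_antisymm this (sq_nonneg _))
  exact ⟨z.re, by linarith, Complex.ext rfl him⟩

end Nonneg

/-! ### Eigenvalues of totally positive matrices -/

/-- If `f` takes its largest values on `S`, with `c` a threshold, then `S` maximizes the product of
`f` among the sets of the same size. -/
theorem prod_le_prod_of_threshold {α : Type*} [DecidableEq α] {f : α → ℝ} (hf : ∀ i, 0 ≤ f i)
    {c : ℝ} (hc : 0 ≤ c) {S R : Finset α} (hS : ∀ i ∈ S, c ≤ f i) (hS' : ∀ i ∉ S, f i ≤ c)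
    (hcard : R.card = S.card) : ∏ i ∈ R, f i ≤ ∏ i ∈ S, f i := by
  have hcard' : (R \ S).card = (S \ R).card := by
    have h1 := card_sdiff_add_card_inter R S
    have h2 := card_sdiff_add_card_inter S R
    rw [inter_comm] at h2
    omega
  rw [← prod_inter_mul_prod_sdiff R S f, ← prod_inter_mul_prod_sdiff S R f, inter_comm S R]
  refine mul_le_mul_of_nonneg_left ?_ (prod_nonneg fun i _ => hf i)
  calc ∏ i ∈ R \ S, f i ≤ ∏ _i ∈ R \ S, c :=
        prod_le_prod (fun i _ => hf i) fun i hi => hS' i (mem_sdiff.1 hi).2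
    _ = ∏ _i ∈ S \ R, c := by rw [prod_const, prod_const, hcard']
    _ ≤ ∏ i ∈ S \ R, f i := prod_le_prod (fun _ _ => hc) fun i hi => hS i (mem_sdiff.1 hi).1

/-- The eigenvalues of a nonsingular totally positive matrix are positive (Gantmacher–Krein). Its
compound matrices are nonnegative with positive diagonal, so a product of `k` eigenvalues of maximal
modulus is positive. An eigenvalue `z` is the quotient of two such products: over the eigenvalues
of modulus larger than `|z|` together with `z`, and without `z`. -/
theorem IsTP.eigenvalue_pos {n : ℕ} {A : Matrix (Fin n) (Fin n) ℝ} (hA : IsTP A)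
    (hdet : IsUnit A.det) {z : ℂ} (hz : z ∈ spectrum ℂ (A.map Complex.ofReal)) :
    ∃ x : ℝ, 0 < x ∧ z = x := by
  obtain ⟨P, T, hP, hT, hPT⟩ := exists_upperTriangular n (A.map Complex.ofReal)
  have hspec : ∀ k (y : ℂ), y ∈ spectrum ℂ ((compound k A).map Complex.ofReal) ↔
      ∃ S : Fin k ↪o Fin n, y = ∏ i, T (S i) (S i) := by
    intro k y
    rw [← mem_spectrum_compound_iff hP hT hPT k y]
    exact iff_of_eq (congrArg (fun X => y ∈ spectrum ℂ X)
      (compound_map Complex.ofRealHom k A).symm)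
  have hprod : ∀ {k} (S : Fin k ↪o Fin n) (g : Fin n → ℝ),
      ∏ i, g (S i) = ∏ i ∈ univ.map S.toEmbedding, g i := fun S g => by
    rw [prod_map]; rfl
  have hmaxpos : ∀ (S : Finset (Fin n)) (c : ℝ), 0 ≤ c → (∀ i ∈ S, c ≤ ‖T i i‖) →
      (∀ i ∉ S, ‖T i i‖ ≤ c) → ∃ x : ℝ, 0 < x ∧ ∏ i ∈ S, T i i = x := by
    intro S c hc hS hS'
    have e : ∏ i ∈ S, T i i = ∏ i, T (S.orderEmbOfFin rfl i) (S.orderEmbOfFin rfl i) := by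
      conv_lhs => rw [← map_orderEmbOfFin_univ S rfl]
      rw [prod_map]; rfl
    refine eigenvalue_pos_of_forall_norm_le (Q := compound S.card A)
      (fun R U => hA _ R U) (fun R => hA.principal_minor_pos (hA.det_pos hdet) R)
      ((hspec _ _).2 ⟨S.orderEmbOfFin rfl, e⟩) ?_
    intro y hy
    obtain ⟨R, rfl⟩ := (hspec _ _).1 hy
    rw [norm_prod, norm_prod, hprod R fun i => ‖T i i‖]
    exact prod_le_prod_of_threshold (fun i => norm_nonneg _) hc hS hS' (by simp)
  obtain ⟨l, rfl⟩ : ∃ l, z = T l l := by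
    rw [mem_spectrum_iff_det, det_smul_one_sub_eq_of_mul_eq hP hPT,
      det_eq_prod_diag_of_injective Function.injective_id (fun i j hij => ?_),
      prod_eq_zero_iff] at hz
    · obtain ⟨l, -, hl⟩ := hz
      exact ⟨l, by simpa [sub_eq_zero] using hl⟩
    · have hij' : j < i := hij
      simp [hT i j hij', hij'.ne']
  let S : Finset (Fin n) := univ.filter fun i => ‖T l l‖ < ‖T i i‖
  have hlS : l ∉ S := by simp [S]
  obtain ⟨x, hx, hxS⟩ := hmaxpos S ‖T l l‖ (norm_nonneg _)
    (fun i hi => (mem_filter.1 hi).2.le) (fun i hi => by simpa [S] using hi)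
  obtain ⟨y, hy, hyS⟩ := hmaxpos (insert l S) ‖T l l‖ (norm_nonneg _)
    (fun i hi => by
      rcases mem_insert.1 hi with rfl | hi
      · exact le_rfl
      · exact (mem_filter.1 hi).2.le)
    (fun i hi => by
      have : i ∉ S := fun h => hi (mem_insert_of_mem h)
      simpa [S] using this)
  rw [prod_insert hlS, hxS] at hyS
  refine ⟨y / x, div_pos hy hx, ?_⟩
  rw [Complex.ofReal_div, ← hyS, mul_div_cancel_right₀]
  exact_mod_cast hx.ne'

/-- A nonsingular totally positive matrix of positive size has a minimal eigenvalue. -/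
theorem IsTP.exists_isMinEigenvalue {n : ℕ} (hn : 0 < n) {A : Matrix (Fin n) (Fin n) ℝ}
    (hA : IsTP A) (hdet : IsUnit A.det) : ∃ m : ℝ, IsMinEigenvalue A m := by
  have : Nonempty (Fin n) := ⟨⟨0, hn⟩⟩
  have hne := spectrum.nonempty_of_isAlgClosed_of_finiteDimensional ℂ (A.map Complex.ofReal)
  have hfin : (spectrum ℂ (A.map Complex.ofReal)).Finite := Matrix.finite_spectrum _
  obtain ⟨z, hz, hmin⟩ := Set.exists_min_image _ Complex.re hfin hne
  obtain ⟨m, -, rfl⟩ := hA.eigenvalue_pos hdet hz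
  refine ⟨m, hz, fun y hy => ?_⟩
  obtain ⟨x, -, rfl⟩ := hA.eigenvalue_pos hdet hy
  exact ⟨x, rfl, by simpa using hmin _ hy⟩

/-! ### Minimal singular values -/

open InnerProductSpace in
/-- The least singular value of `A` is the minimum of `‖A v‖ / ‖v‖`, and it is attained. -/
theorem minSingularValue_spec (hn : 0 < n) (A : Matrix (Fin n) (Fin n) ℝ) :
    (∃ v : EuclideanSpace ℝ (Fin n), v ≠ 0 ∧
      ‖Matrix.toEuclideanLin A v‖ = minSingularValue A * ‖v‖) ∧
    ∀ v : EuclideanSpace ℝ (Fin n),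
      minSingularValue A * ‖v‖ ≤ ‖Matrix.toEuclideanLin A v‖ := by
  have : Nonempty (Fin n) := ⟨⟨0, hn⟩⟩
  have hfr : Module.finrank ℝ (EuclideanSpace ℝ (Fin n)) = n := finrank_euclideanSpace_fin
  set T := Matrix.toEuclideanLin A with hT
  have hsym := T.isSymmetric_adjoint_comp_self
  let b := hsym.eigenvectorBasis hfr
  have hb : ∀ i, (LinearMap.adjoint T ∘ₗ T) (b i) = (T.singularValues i ^ 2) • b i := by
    intro i
    rw [T.sq_singularValues_fin hfr i]
    exact hsym.apply_eigenvectorBasis hfr i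
  have hnonneg : 0 ≤ minSingularValue A := le_ciInf fun i => T.singularValues_nonneg _
  have hle : ∀ i : Fin n, minSingularValue A ≤ T.singularValues i := fun i =>
    ciInf_le (Set.finite_range _).bddBelow i
  have hsq : ∀ v, ‖T v‖ ^ 2 = ∑ i : Fin n, T.singularValues i ^ 2 * (inner ℝ (b i) v) ^ 2 := by
    intro v
    have h1 : ‖T v‖ ^ 2 = inner ℝ v ((LinearMap.adjoint T ∘ₗ T) v) := by
      rw [LinearMap.comp_apply, LinearMap.adjoint_inner_right, real_inner_self_eq_norm_sq]
    rw [h1, ← b.sum_inner_mul_inner]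
    refine sum_congr rfl fun i _ => ?_
    rw [← hsym (b i) v, hb i, real_inner_smul_left, real_inner_comm]
    ring
  have hnorm : ∀ v, ‖v‖ ^ 2 = ∑ i, (inner ℝ (b i) v) ^ 2 := by
    intro v
    rw [← b.sum_sq_norm_inner_right v]
    simp
  constructor
  · obtain ⟨i, hi⟩ := exists_eq_ciInf_of_finite (f := fun i : Fin n => T.singularValues (i : ℕ))
    have hb1 : ‖b i‖ = 1 := b.norm_eq_one i
    refine ⟨b i, fun h0 => by simp [h0] at hb1, ?_⟩
    rw [hb1, mul_one]
    have h2 : ‖T (b i)‖ ^ 2 = minSingularValue A ^ 2 := by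
      have h1 : ‖T (b i)‖ ^ 2 = inner ℝ (b i) ((LinearMap.adjoint T ∘ₗ T) (b i)) := by
        rw [LinearMap.comp_apply, LinearMap.adjoint_inner_right, real_inner_self_eq_norm_sq]
      rw [h1, hb i, real_inner_smul_right, real_inner_self_eq_norm_sq, hb1, one_pow, mul_one]
      exact congrArg (· ^ 2) hi
    exact (pow_left_inj₀ (norm_nonneg _) hnonneg two_ne_zero).1 h2
  · intro v
    refine le_of_sq_le_sq ?_ (norm_nonneg _)
    rw [mul_pow, hsq, hnorm, mul_sum]
    exact sum_le_sum fun i _ =>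
      mul_le_mul_of_nonneg_right (pow_le_pow_left₀ hnonneg (hle i) 2) (sq_nonneg _)

/-! ### Consequences of domination of inverses -/

theorem abs_mulVec_le (A : Matrix (Fin n) (Fin n) ℝ) (v : Fin n → ℝ) (i : Fin n) :
    |(A *ᵥ v) i| ≤ (absMatrix A *ᵥ fun j => |v j|) i := by
  simp only [mulVec, dotProduct]
  exact (abs_sum_le_sum_abs _ _).trans_eq (sum_congr rfl fun _ _ => abs_mul _ _)

theorem mulVec_le_mulVec_of_le {B B' : Matrix (Fin n) (Fin n) ℝ} (h : ∀ i j, B i j ≤ B' i j)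
    {w : Fin n → ℝ} (hw : ∀ j, 0 ≤ w j) (i : Fin n) : (B *ᵥ w) i ≤ (B' *ᵥ w) i := by
  simp only [mulVec, dotProduct]
  exact sum_le_sum fun j _ => mul_le_mul_of_nonneg_right (h i j) (hw j)

/-- The minimal eigenvalue decreases when `|M⁻¹|` increases: it is the reciprocal of the spectral
radius of `|M⁻¹|`, which is similar to `M⁻¹`. -/
theorem isMinEigenvalue_le_of_dominates {M X : Matrix (Fin n) (Fin n) ℝ} (hM : IsTP M)
    (hMdet : IsUnit M.det) (hX : IsTP X) (hXdet : IsUnit X.det)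
    (h : Dominates (absMatrix X⁻¹) M⁻¹) {m x : ℝ} (hm : IsMinEigenvalue M m)
    (hx : IsMinEigenvalue X x) : x ≤ m := by
  obtain ⟨m', hm0, hmm'⟩ := hM.eigenvalue_pos hMdet hm.1
  obtain rfl : m = m' := Complex.ofReal_injective hmm'
  -- a real eigenvector
  obtain ⟨v, hv, hMv⟩ : ∃ v ≠ 0, M *ᵥ v = m • v := by
    rw [← mem_spectrum_iff_exists_mulVec, mem_spectrum_iff_det]
    have h1 := (mem_spectrum_iff_det _ _).1 hm.1
    have h2 : ((m : ℂ) • (1 : Matrix (Fin n) (Fin n) ℂ) - M.map Complex.ofReal)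
        = (m • (1 : Matrix (Fin n) (Fin n) ℝ) - M).map Complex.ofRealHom := by
      ext i j
      by_cases hij : i = j <;> simp [one_apply, hij]
    rw [h2, ← RingHom.mapMatrix_apply, ← RingHom.map_det] at h1
    exact Complex.ofReal_eq_zero.1 h1
  have hv' : M⁻¹ *ᵥ v = m⁻¹ • v := by
    have : m • (M⁻¹ *ᵥ v) = v := by
      rw [← mulVec_smul, ← hMv, mulVec_mulVec, nonsing_inv_mul _ hMdet, one_mulVec]
    rw [← this, smul_smul, inv_mul_cancel₀ hm0.ne', one_smul, this]
  obtain ⟨y, hy, hmy⟩ := exists_eigenvalue_of_smul_le_mulVec (absMatrix_nonneg X⁻¹)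
    (w := fun i => |v i|) (fun i => abs_nonneg _)
    (fun e => hv (funext fun i => abs_eq_zero.1 (congrFun e i))) (inv_nonneg.2 hm0.le) (by
      intro i
      calc m⁻¹ * |v i| = |(M⁻¹ *ᵥ v) i| := by
            rw [hv', Pi.smul_apply, smul_eq_mul, abs_mul, abs_of_pos (inv_pos.2 hm0)]
        _ ≤ _ := abs_mulVec_le _ _ i
        _ ≤ _ := mulVec_le_mulVec_of_le h.2 (fun j => abs_nonneg _) i)
  have hy0 : y ≠ 0 := by
    rintro rfl
    rw [norm_zero] at hmy
    exact absurd (inv_pos.2 hm0) (not_lt.2 hmy)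
  -- `y⁻¹` is an eigenvalue of `X`, by the similarity of `|X⁻¹|` and `X⁻¹`
  have hyX : y⁻¹ ∈ spectrum ℂ (X.map Complex.ofReal) := by
    let f := Complex.ofRealHom.mapMatrix (m := Fin n)
    have hD : f (altSign n) * f (altSign n) = 1 := by
      rw [← map_mul, altSign_mul_self, map_one]
    have hXX : f X * f X⁻¹ = 1 := by rw [← map_mul, mul_nonsing_inv _ hXdet, map_one]
    obtain ⟨u, hu, hBu⟩ := (mem_spectrum_iff_exists_mulVec _ _).1 hy
    have hB : (absMatrix X⁻¹).map Complex.ofReal = f (altSign n) * f X⁻¹ * f (altSign n) := by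
      rw [← map_mul, ← map_mul, ← hX.absMatrix_inv]; rfl
    refine (mem_spectrum_iff_exists_mulVec _ _).2 ⟨f (altSign n) *ᵥ u, ?_, ?_⟩
    · intro h0
      apply hu
      rw [← one_mulVec u, ← hD, ← mulVec_mulVec, h0, mulVec_zero]
    · have h1 : f X⁻¹ *ᵥ (f (altSign n) *ᵥ u) = y • (f (altSign n) *ᵥ u) := by
        rw [← mulVec_smul, ← hBu, hB, mulVec_mulVec, mulVec_mulVec, ← Matrix.mul_assoc,
          ← Matrix.mul_assoc, hD, Matrix.one_mul]
      have h2 : f X *ᵥ (y • (f (altSign n) *ᵥ u)) = f (altSign n) *ᵥ u := by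
        rw [← h1, mulVec_mulVec, hXX, one_mulVec]
      rw [mulVec_smul] at h2
      calc X.map Complex.ofReal *ᵥ (f (altSign n) *ᵥ u)
          = y⁻¹ • y • (f X *ᵥ (f (altSign n) *ᵥ u)) := by
            rw [smul_smul, inv_mul_cancel₀ hy0, one_smul]; rfl
        _ = _ := by rw [h2]
  obtain ⟨t, ht, hty⟩ := hX.eigenvalue_pos hXdet hyX
  obtain ⟨t', htt', hxt⟩ := hx.2 _ hyX
  obtain rfl : t = t' := Complex.ofReal_injective (hty.symm.trans htt')
  refine hxt.trans ?_
  have hnt : t = ‖y‖⁻¹ := by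
    rw [← norm_inv, hty, Complex.norm_real, Real.norm_eq_abs, abs_of_pos ht]
  rw [hnt]
  exact inv_le_of_inv_le₀ hm0 hmy

/-- If `v` is a singular vector of `M` for its least singular value and `u = M v`, then the vector
`X⁻¹ D |u| = D |X⁻¹| |u|` is at least as long as `v`, and `X` maps it to a vector as long as
`u`. -/
theorem minSingularValue_le_of_dominates (hn : 0 < n) {M X : Matrix (Fin n) (Fin n) ℝ}
    (hMdet : IsUnit M.det) (hX : IsTP X) (hXdet : IsUnit X.det)
    (h : Dominates (absMatrix X⁻¹) M⁻¹) : minSingularValue X ≤ minSingularValue M := by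
  obtain ⟨⟨v, hv, hMv⟩, -⟩ := minSingularValue_spec hn M
  have hXle := (minSingularValue_spec hn X).2
  let u : Fin n → ℝ := M *ᵥ v.ofLp
  let p : Fin n → ℝ := absMatrix X⁻¹ *ᵥ fun i => |u i|
  have hD : ∀ w : Fin n → ℝ, ‖WithLp.toLp 2 (altSign n *ᵥ w)‖ = ‖WithLp.toLp 2 w‖ := by
    intro w
    rw [EuclideanSpace.norm_eq, EuclideanSpace.norm_eq]
    congr 1
    refine sum_congr rfl fun i _ => ?_
    simp [altSign, mulVec_diagonal]
  have habs : ‖WithLp.toLp 2 (fun i => |u i|)‖ = ‖WithLp.toLp 2 u‖ := by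
    rw [EuclideanSpace.norm_eq, EuclideanSpace.norm_eq]
    simp
  have hvp : ‖v‖ ≤ ‖WithLp.toLp 2 p‖ := by
    rw [EuclideanSpace.norm_eq, EuclideanSpace.norm_eq]
    refine Real.sqrt_le_sqrt (sum_le_sum fun i _ => pow_le_pow_left₀ (norm_nonneg _) ?_ 2)
    have hvi : v.ofLp = M⁻¹ *ᵥ u := by
      rw [mulVec_mulVec, nonsing_inv_mul _ hMdet, one_mulVec]
    refine le_trans ?_ (le_abs_self _)
    rw [Real.norm_eq_abs, hvi]
    exact (abs_mulVec_le _ _ i).trans (mulVec_le_mulVec_of_le h.2 (fun j => abs_nonneg _) i)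
  have hXp : X *ᵥ (altSign n *ᵥ p) = altSign n *ᵥ fun i => |u i| := by
    simp only [p]
    rw [hX.absMatrix_inv, mulVec_mulVec, mulVec_mulVec, Matrix.mul_assoc (altSign n),
      Matrix.mul_assoc X, ← Matrix.mul_assoc (altSign n) (altSign n), altSign_mul_self, Matrix.one_mul,
      ← Matrix.mul_assoc, mul_nonsing_inv _ hXdet, Matrix.one_mul]
  have hfinal : minSingularValue X * ‖v‖ ≤ minSingularValue M * ‖v‖ := by
    have h0 : 0 ≤ minSingularValue X :=
      Real.iInf_nonneg fun i => LinearMap.singularValues_nonneg _ _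
    calc minSingularValue X * ‖v‖ ≤ minSingularValue X * ‖WithLp.toLp 2 p‖ :=
          mul_le_mul_of_nonneg_left hvp h0
      _ = minSingularValue X * ‖WithLp.toLp 2 (altSign n *ᵥ p)‖ := by rw [hD]
      _ ≤ ‖Matrix.toEuclideanLin X (WithLp.toLp 2 (altSign n *ᵥ p))‖ := hXle _
      _ = ‖WithLp.toLp 2 (altSign n *ᵥ fun i => |u i|)‖ := by rw [← hXp]; rfl
      _ = ‖WithLp.toLp 2 u‖ := by rw [hD, habs]
      _ = minSingularValue M * ‖v‖ := hMv
  exact le_of_mul_le_mul_right hfinal (norm_pos_iff.2 hv)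

theorem normInf_inv_le_of_dominates {M X : Matrix (Fin n) (Fin n) ℝ}
    (h : Dominates (absMatrix X⁻¹) M⁻¹) : normInf M⁻¹ ≤ normInf X⁻¹ :=
  ciSup_mono (Set.finite_range _).bddAbove fun i => sum_le_sum fun j _ => h.2 i j

theorem normOne_inv_le_of_dominates {M X : Matrix (Fin n) (Fin n) ℝ}
    (h : Dominates (absMatrix X⁻¹) M⁻¹) : normOne M⁻¹ ≤ normOne X⁻¹ :=
  ciSup_mono (Set.finite_range _).bddAbove fun j => sum_le_sum fun i _ => h.2 i j

theorem normOne_transpose (A : Matrix (Fin n) (Fin n) ℝ) : normOne Aᵀ = normInf A := rfl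

/-- Right multiplication by a stochastic matrix preserves the row sums, hence the `∞`-norm of a
nonnegative matrix. -/
theorem normInf_mul_of_rowStochastic {M K : Matrix (Fin n) (Fin n) ℝ} (hM : ∀ i j, 0 ≤ M i j)
    (hK : K ∈ rowStochastic ℝ (Fin n)) : normInf (M * K) = normInf M := by
  refine iSup_congr fun i => ?_
  have hnn : ∀ j, 0 ≤ (M * K) i j := fun j => by
    rw [mul_apply]
    exact sum_nonneg fun l _ => mul_nonneg (hM i l) (nonneg_of_mem_rowStochastic hK)
  calc ∑ j, |(M * K) i j| = ∑ j, ∑ l, M i l * K l j :=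
        sum_congr rfl fun j _ => abs_of_nonneg (hnn j)
    _ = ∑ l, M i l * ∑ j, K l j := by
      rw [sum_comm]
      exact sum_congr rfl fun l _ => (mul_sum _ _ _).symm
    _ = ∑ l, |M i l| := sum_congr rfl fun l _ => by
      rw [sum_row_of_mem_rowStochastic hK, mul_one, abs_of_nonneg (hM i l)]

theorem normInf_nonneg (A : Matrix (Fin n) (Fin n) ℝ) : 0 ≤ normInf A :=
  Real.iSup_nonneg fun _ => sum_nonneg fun _ _ => abs_nonneg _

theorem normOne_nonneg (A : Matrix (Fin n) (Fin n) ℝ) : 0 ≤ normOne A :=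
  Real.iSup_nonneg fun _ => sum_nonneg fun _ _ => abs_nonneg _

/-- `|(MK)⁻¹| = |K⁻¹| |M⁻¹|`, and `|K⁻¹|` has diagonal entries at least `1`. -/
theorem dominates_absMatrix_mul_inv_right {M K : Matrix (Fin n) (Fin n) ℝ} (hM : IsTP M) (hK : IsTP K)
    (hKdet : IsUnit K.det) (hK1 : ∀ i, K i i ≤ 1) : Dominates (absMatrix (M * K)⁻¹) M⁻¹ := by
  refine ⟨fun i j => absMatrix_nonneg _ i j, fun i j => ?_⟩
  rw [hM.absMatrix_mul_inv hK, mul_apply]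
  calc absMatrix M⁻¹ i j ≤ absMatrix K⁻¹ i i * absMatrix M⁻¹ i j :=
        le_mul_of_one_le_left (absMatrix_nonneg _ _ _) (hK.one_le_absMatrix_inv_diag hKdet (hK1 i))
    _ ≤ _ := single_le_sum (f := fun l => absMatrix K⁻¹ i l * absMatrix M⁻¹ l j)
      (fun l _ => mul_nonneg (absMatrix_nonneg _ _ _) (absMatrix_nonneg _ _ _)) (mem_univ i)

theorem dominates_absMatrix_mul_inv_left {M K : Matrix (Fin n) (Fin n) ℝ} (hM : IsTP M) (hK : IsTP K)
    (hKdet : IsUnit K.det) (hK1 : ∀ i, K i i ≤ 1) : Dominates (absMatrix (K * M)⁻¹) M⁻¹ := by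
  refine ⟨fun i j => absMatrix_nonneg _ i j, fun i j => ?_⟩
  rw [hK.absMatrix_mul_inv hM, mul_apply]
  calc absMatrix M⁻¹ i j ≤ absMatrix M⁻¹ i j * absMatrix K⁻¹ j j :=
        le_mul_of_one_le_right (absMatrix_nonneg _ _ _) (hK.one_le_absMatrix_inv_diag hKdet (hK1 j))
    _ ≤ _ := single_le_sum (f := fun l => absMatrix M⁻¹ i l * absMatrix K⁻¹ l j)
      (fun l _ => mul_nonneg (absMatrix_nonneg _ _ _) (absMatrix_nonneg _ _ _)) (mem_univ j)

end TPCond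

theorem corollary3p2 (n : ℕ) (hn : 0 < n) (M K A C : Matrix (Fin n) (Fin n) ℝ)
    (hM : TPCond.IsTP M) (hMdet : IsUnit M.det)
    (hK : TPCond.IsTP K) (hKdet : IsUnit K.det) (hKst : K ∈ Matrix.rowStochastic ℝ (Fin n))
    (hA : A = M * K) (hC : C = K.transpose * M) :
    -- (i)
    (TPCond.Dominates (TPCond.absMatrix A⁻¹) M⁻¹ ∧
      TPCond.Dominates (TPCond.absMatrix C⁻¹) M⁻¹) ∧
    -- (ii)
    (∃ m a c : ℝ, TPCond.IsMinEigenvalue M m ∧ TPCond.IsMinEigenvalue A a ∧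
      TPCond.IsMinEigenvalue C c ∧ a ≤ m ∧ c ≤ m) ∧
    -- (iii)
    (TPCond.minSingularValue A ≤ TPCond.minSingularValue M ∧
      TPCond.minSingularValue C ≤ TPCond.minSingularValue M) ∧
    -- (iv)
    (TPCond.condInf M ≤ TPCond.condInf A ∧ TPCond.condOne M ≤ TPCond.condOne C) := by
  have hATP : TPCond.IsTP A := hA ▸ hM.mul hK
  have hCTP : TPCond.IsTP C := hC ▸ hK.transpose.mul hM
  have hKTdet : IsUnit K.transpose.det := by rwa [Matrix.det_transpose]
  have hAdet : IsUnit A.det := by rw [hA, Matrix.det_mul]; exact hMdet.mul hKdet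
  have hCdet : IsUnit C.det := by rw [hC, Matrix.det_mul]; exact hKTdet.mul hMdet
  have hK1 : ∀ i, K i i ≤ 1 := fun i => Matrix.le_one_of_mem_rowStochastic hKst
  have hAdom : TPCond.Dominates (TPCond.absMatrix A⁻¹) M⁻¹ :=
    hA ▸ TPCond.dominates_absMatrix_mul_inv_right hM hK hKdet hK1
  have hCdom : TPCond.Dominates (TPCond.absMatrix C⁻¹) M⁻¹ :=
    hC ▸ TPCond.dominates_absMatrix_mul_inv_left hM hK.transpose hKTdet hK1
  obtain ⟨m, hm⟩ := hM.exists_isMinEigenvalue hn hMdet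
  obtain ⟨a, ha⟩ := hATP.exists_isMinEigenvalue hn hAdet
  obtain ⟨c, hc⟩ := hCTP.exists_isMinEigenvalue hn hCdet
  have hnA : TPCond.normInf A = TPCond.normInf M := by
    rw [hA, TPCond.normInf_mul_of_rowStochastic hM.apply_nonneg hKst]
  have hnC : TPCond.normOne C = TPCond.normOne M := by
    have h1 : C = (M.transpose * K).transpose := by
      rw [hC, Matrix.transpose_mul, Matrix.transpose_transpose]
    rw [h1, TPCond.normOne_transpose,
      TPCond.normInf_mul_of_rowStochastic hM.transpose.apply_nonneg hKst]
    rfl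
  refine ⟨⟨hAdom, hCdom⟩, ⟨m, a, c, hm, ha, hc,
    TPCond.isMinEigenvalue_le_of_dominates hM hMdet hATP hAdet hAdom hm ha,
    TPCond.isMinEigenvalue_le_of_dominates hM hMdet hCTP hCdet hCdom hm hc⟩,
    ⟨TPCond.minSingularValue_le_of_dominates hn hMdet hATP hAdet hAdom,
      TPCond.minSingularValue_le_of_dominates hn hMdet hCTP hCdet hCdom⟩, ?_, ?_⟩
  · rw [TPCond.condInf, TPCond.condInf, hnA]
    exact mul_le_mul_of_nonneg_left (TPCond.normInf_inv_le_of_dominates hAdom)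
      (TPCond.normInf_nonneg M)
  · rw [TPCond.condOne, TPCond.condOne, hnC]
    exact mul_le_mul_of_nonneg_left (TPCond.normOne_inv_le_of_dominates hCdom)
      (TPCond.normOne_nonneg M)
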